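/- Let $d\ge 1$ and let $\Omega\subset\mathbb{R}^d$ be a bounded domain (a nonempty, connected, bounded open set). Let $0<\lambda_1(\Omega)\le\lambda_2(\Omega)\le\cdots$ be the eigenvalues of the Dirichlet Laplacian $-\Delta$ on $\Omega$, repeated according to multiplicity; that is, the numbers $\mu$ for which there is $0\ne u\in H^1_0(\Omega)$ with $\int_\Omega\nabla u\cdot\nabla v=\mu\int_\Omega uv$ for all $v\in H^1_0(\Omega)$. For real $\Lambda$ let $$R_\Lambda(\Omega)=\sum_{j\ge1,\ \lambda_j(\Omega)<\Lambda}(\Lambda-\lambda_j(\Omega))_+$$ be the Riesz mean of order one, which is a finite sum. Then for every integer $k\ge1$ $$A_\Omega(k):=\frac1k\sum_{j=1}^k\lambda_j(\Omega)=\sup_{\Lambda>0}\Bigl(\Lambda-\frac{R_\Lambda(\Omega)}{k}\Bigr),$$ and the supremum is attained at $\Lambda=\lambda_k(\Omega)>0$. -/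

import Mathlib

open MeasureTheory
open scoped ContDiff

noncomputable section

/-- The real Hilbert space `L²(Ω)` (Lebesgue measure on `Ω`). -/
abbrev L2 {d : ℕ} (Ω : Set (EuclideanSpace ℝ (Fin d))) : Type :=
  Lp ℝ 2 (volume.restrict Ω)

/-- The Hilbert space `L²(Ω; ℝᵈ)` of square integrable vector fields on `Ω`. -/
abbrev L2Vec {d : ℕ} (Ω : Set (EuclideanSpace ℝ (Fin d))) : Type :=
  Lp (EuclideanSpace ℝ (Fin d)) 2 (volume.restrict Ω)

/-- `φ ∈ C_c^∞(Ω)`: smooth with compact support contained in `Ω`. -/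
def IsTestFunction {d : ℕ} (Ω : Set (EuclideanSpace ℝ (Fin d)))
    (φ : EuclideanSpace ℝ (Fin d) → ℝ) : Prop :=
  ContDiff ℝ ∞ φ ∧ HasCompactSupport φ ∧ tsupport φ ⊆ Ω

/-- The pairs `(φ, ∇φ)` with `φ ∈ C_c^∞(Ω)`, as a subspace of `L²(Ω) × L²(Ω; ℝᵈ)`. -/
def testPairs {d : ℕ} (Ω : Set (EuclideanSpace ℝ (Fin d))) :
    Submodule ℝ (WithLp 2 (L2 Ω × L2Vec Ω)) where
  carrier := {p | ∃ φ : EuclideanSpace ℝ (Fin d) → ℝ, IsTestFunction Ω φ ∧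
    p.fst =ᵐ[volume.restrict Ω] φ ∧ p.snd =ᵐ[volume.restrict Ω] gradient φ}
  add_mem' := by
    rintro p q ⟨φ, ⟨hφ, hφc, hφs⟩, hp1, hp2⟩ ⟨ψ, ⟨hψ, hψc, hψs⟩, hq1, hq2⟩
    refine ⟨φ + ψ, ⟨hφ.add hψ, hφc.add hψc,
      (tsupport_add φ ψ).trans (Set.union_subset hφs hψs)⟩, ?_, ?_⟩
    · filter_upwards [Lp.coeFn_add p.fst q.fst, hp1, hq1] with x hx h1 h2
      rw [WithLp.add_fst, hx, Pi.add_apply, Pi.add_apply, h1, h2]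
    · filter_upwards [Lp.coeFn_add p.snd q.snd, hp2, hq2] with x hx h1 h2
      rw [WithLp.add_snd, hx, Pi.add_apply, h1, h2, gradient, gradient, gradient,
        fderiv_add (hφ.differentiable (by simp) x) (hψ.differentiable (by simp) x), map_add]
  zero_mem' := by
    refine ⟨0, ⟨contDiff_const, HasCompactSupport.zero, by simp [tsupport]⟩, ?_, ?_⟩
    · exact Lp.coeFn_zero _ _ _
    · filter_upwards [Lp.coeFn_zero (EuclideanSpace ℝ (Fin d)) 2 (volume.restrict Ω)] with x hx
      rw [WithLp.zero_snd, hx]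
      simp [gradient]
  smul_mem' := by
    rintro c p ⟨φ, ⟨hφ, hφc, hφs⟩, hp1, hp2⟩
    refine ⟨c • φ, ⟨hφ.const_smul c, hφc.smul_left (f := fun _ => c),
      (tsupport_smul_subset_right (fun _ => c) φ).trans hφs⟩, ?_, ?_⟩
    · filter_upwards [Lp.coeFn_smul c p.fst, hp1] with x hx h1
      rw [WithLp.smul_fst, hx, Pi.smul_apply, Pi.smul_apply, h1]
    · filter_upwards [Lp.coeFn_smul c p.snd, hp2] with x hx h1
      rw [WithLp.smul_snd, hx, Pi.smul_apply, h1, gradient, gradient,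
        fderiv_const_smul (hφ.differentiable (by simp) x), map_smul]

/-- The Sobolev space `H¹₀(Ω)`, the closure of `C_c^∞(Ω)` for the norm
`(‖u‖² + ‖∇u‖²)^(1/2)`. An element `u` is recorded together with its weak gradient, as the pair
`(u, ∇u) ∈ L²(Ω) × L²(Ω; ℝᵈ)`; the second component is determined by the first one. -/
def sobolevH10 {d : ℕ} (Ω : Set (EuclideanSpace ℝ (Fin d))) :
    Submodule ℝ (WithLp 2 (L2 Ω × L2Vec Ω)) :=
  (testPairs Ω).topologicalClosure

/-- `u` is an eigenfunction of the Dirichlet Laplacian `-Δ` on `Ω` with eigenvalue `μ`: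
`0 ≠ u ∈ H¹₀(Ω)` and `∫_Ω ∇u · ∇v = μ ∫_Ω u v` for all `v ∈ H¹₀(Ω)`. -/
def IsDirichletEigenpair {d : ℕ} (Ω : Set (EuclideanSpace ℝ (Fin d))) (μ : ℝ) (u : L2 Ω) :
    Prop :=
  u ≠ 0 ∧ ∃ gradu : L2Vec Ω, WithLp.toLp 2 (u, gradu) ∈ sobolevH10 Ω ∧
    ∀ v ∈ sobolevH10 Ω, inner ℝ gradu v.snd = μ * inner ℝ u v.fst

/-- The `k`-th Dirichlet eigenvalue `λ_k(Ω)`, `k ≥ 1`, in nondecreasing order and counted with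
multiplicity: the least `Λ` such that there are `k` orthonormal (in `L²(Ω)`) Dirichlet
eigenfunctions with eigenvalues at most `Λ`. (The value at `k = 0` has no meaning.) -/
def dirichletEigenvalue {d : ℕ} (Ω : Set (EuclideanSpace ℝ (Fin d))) (k : ℕ) : ℝ :=
  sInf {Λ : ℝ | ∃ u : Fin k → L2 Ω, Orthonormal ℝ u ∧
    ∀ i, ∃ μ ≤ Λ, IsDirichletEigenpair Ω μ (u i)}

/-- The Riesz mean `R_Λ(Ω) = ∑_{λ_j < Λ} (Λ - λ_j)₊` of order one; `j` runs over `j ≥ 1`. -/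
def rieszMean {d : ℕ} (Ω : Set (EuclideanSpace ℝ (Fin d))) (Λ : ℝ) : ℝ :=
  ∑ᶠ j ∈ {j : ℕ | 1 ≤ j ∧ dirichletEigenvalue Ω j < Λ}, max (Λ - dirichletEigenvalue Ω j) 0

/-- The Cesàro average `A_Ω(k) = (1/k) ∑_{j=1}^k λ_j(Ω)`. -/
def cesaroAverage {d : ℕ} (Ω : Set (EuclideanSpace ℝ (Fin d))) (k : ℕ) : ℝ :=
  (1 / (k : ℝ)) * ∑ j ∈ Finset.Icc 1 k, dirichletEigenvalue Ω j

end

/-! For each `Λ`, the sum of `Λ - λ_j` over `j ≤ k` equals `k (Λ - A(k))`. It is at most `R_Λ`,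
since the Riesz mean collects all positive terms and the discarded ones are nonpositive; dividing by
`k` gives the upper bound. At `Λ = λ_k` monotonicity leaves no positive term beyond `k` and no
negative term up to `k`, so equality holds. This is `isLUB_sub_rieszMean`, which needs only that the
sequence is nondecreasing, has finitely many terms below each level, and has `λ_k > 0`.

The rest derives these properties from the definition of `λ_k` as an infimum, without showing that
it is attained. Positivity comes from the Friedrichs inequality. Finiteness comes from Rellich's
theorem: orthonormal eigenfunctions with eigenvalues below `Λ` lie in a compact set of `L²`, which
bounds their number. The infimum is over a nonempty set because, with `J : H¹₀ → L²` the embedding,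
`J J*` is compact and symmetric, its eigenvectors for nonzero eigenvalues are Dirichlet
eigenfunctions, and it has arbitrarily many orthonormal ones.

Both inequalities rest on one estimate: translating a smooth function by `h` changes it in `L²` by
at most `|h|` times the norm of its gradient. -/

/-! ### Orthonormal families -/

/-- A compact set contains only orthonormal families of bounded size. -/
theorem IsCompact.exists_card_orthonormal_le {E : Type*} [NormedAddCommGroup E]
    [InnerProductSpace ℝ E] {K : Set E} (hK : IsCompact K) :
    ∃ N : ℕ, ∀ (n : ℕ) (u : Fin n → E), Orthonormal ℝ u → (∀ i, u i ∈ K) → n ≤ N := by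
  -- Orthonormal vectors are at distance `√2 > 1`, so a ball of radius `1/2` contains at most one of
  -- them.
  obtain ⟨t, ht, hcov⟩ := Metric.totallyBounded_iff.1 hK.totallyBounded (1 / 2) (by norm_num)
  refine ⟨ht.toFinset.card, fun n u hu huK => ?_⟩
  have hmem : ∀ i, ∃ y ∈ ht.toFinset, dist (u i) y < 1 / 2 := fun i => by
    have := hcov (huK i)
    simp only [Set.mem_iUnion, Metric.mem_ball] at this
    obtain ⟨y, hy, h⟩ := this
    exact ⟨y, by simpa using hy, h⟩
  choose f hf hd using hmem
  by_contra! hlt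
  obtain ⟨i, -, j, -, hij, hfij⟩ := Finset.exists_ne_map_eq_of_card_lt_of_maps_to
    (s := Finset.univ) (by simpa using hlt) (f := f) (fun i _ => hf i)
  have h1 : dist (u i) (u j) < 1 := by
    have h2 := hd j
    rw [← hfij] at h2
    linarith [dist_triangle_right (u i) (u j) (f i), hd i]
  have h3 : ‖u i - u j‖ ^ 2 = 2 := by
    rw [@norm_sub_sq_real, hu.1, hu.1, hu.2 hij]; norm_num
  rw [dist_eq_norm] at h1
  nlinarith [norm_nonneg (u i - u j)]

theorem Orthonormal.fin_cons {E : Type*} [NormedAddCommGroup E] [InnerProductSpace ℝ E]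
    {n : ℕ} {u : Fin n → E} (hu : Orthonormal ℝ u) {x : E} (hx : ‖x‖ = 1)
    (hxu : ∀ i, inner ℝ x (u i) = 0) :
    Orthonormal ℝ (Fin.cons x u : Fin (n + 1) → E) := by
  refine ⟨fun i => ?_, fun i j hij => ?_⟩
  · cases i using Fin.cases with
    | zero => simpa using hx
    | succ i => simpa using hu.1 i
  · cases i using Fin.cases with
    | zero =>
      cases j using Fin.cases with
      | zero => exact absurd rfl hij
      | succ j => simpa using hxu j
    | succ i =>
      cases j using Fin.cases with
      | zero => simpa [real_inner_comm] using hxu i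
      | succ j => simpa using hu.2 (fun h => hij (by rw [h]))

/-- A compact symmetric operator that does not vanish on the orthogonal complement of any
finite-dimensional subspace has arbitrarily many orthonormal eigenvectors with nonzero
eigenvalues. -/
theorem ContinuousLinearMap.exists_orthonormal_eigenvectors {E : Type*} [NormedAddCommGroup E]
    [InnerProductSpace ℝ E] [CompleteSpace E] {T : E →L[ℝ] E} (hT : IsCompactOperator T)
    (hT' : T.IsSymmetric)
    (hne : ∀ W : Submodule ℝ E, FiniteDimensional ℝ W → ∃ x ∈ Wᗮ, T x ≠ 0) (n : ℕ) :
    ∃ u : Fin n → E, Orthonormal ℝ u ∧ ∀ i, ∃ t : ℝ, t ≠ 0 ∧ T (u i) = t • u i := by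
  induction n with
  | zero => exact ⟨Fin.elim0, ⟨fun i => i.elim0, fun i => i.elim0⟩, fun i => i.elim0⟩
  | succ n ih =>
    obtain ⟨u, hu, hTu⟩ := ih
    set W := Submodule.span ℝ (Set.range u) with hW
    have huW : ∀ i, u i ∈ W := fun i => Submodule.subset_span ⟨i, rfl⟩
    have hinv : ∀ x ∈ Wᗮ, T x ∈ Wᗮ := fun x hx => by
      -- By symmetry `⟨T x, u i⟩ = ⟨x, T (u i)⟩ = 0`. Stating orthogonality as an inclusion of `W`
      -- reduces it to the generators `u i`.
      have hle : W ≤ (Submodule.span ℝ {T x})ᗮ := by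
        rw [hW, Submodule.span_le]
        rintro _ ⟨i, rfl⟩
        obtain ⟨t, -, ht⟩ := hTu i
        rw [SetLike.mem_coe, Submodule.mem_orthogonal_singleton_iff_inner_right]
        have h := hT' x (u i)
        simp only [ContinuousLinearMap.coe_coe] at h
        rw [h, ht, inner_smul_right, real_inner_comm,
          (Submodule.mem_orthogonal W x).1 hx _ (huW i), mul_zero]
      rw [Submodule.mem_orthogonal]
      intro w hw
      have := hle hw
      rwa [Submodule.mem_orthogonal_singleton_iff_inner_left] at this
    have hSc : IsCompactOperator (T.restrict hinv) := hT.restrict' hinv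
    have hSs : (T.restrict hinv).IsSymmetric := hT'.restrict_invariant hinv
    have hS0 : T.restrict hinv ≠ 0 := by
      obtain ⟨x, hx, hTx⟩ := hne W (FiniteDimensional.span_of_finite ℝ (Set.finite_range u))
      intro h
      have h0 := DFunLike.congr_fun h (⟨x, hx⟩ : Wᗮ)
      exact hTx (congrArg Subtype.val h0)
    -- A nonzero compact symmetric operator has a nonzero eigenvalue; an eigenvector of the
    -- restriction to `Wᗮ` extends the family.
    have hex := mt (ContinuousLinearMap.eq_zero_of_forall_hasEigenvalue_eq_zero hSc hSs).1 hS0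
    push Not at hex
    obtain ⟨t, ht, ht0⟩ := hex
    obtain ⟨y, hy⟩ := ht.exists_hasEigenvector
    have hTy : T (y : E) = t • (y : E) := congrArg Subtype.val hy.apply_eq_smul
    have hy0 : ‖(y : E)‖ ≠ 0 := by simpa using hy.2
    refine ⟨Fin.cons (‖(y : E)‖⁻¹ • (y : E)) u, hu.fin_cons ?_ fun i => ?_, fun i => ?_⟩
    · rw [norm_smul, norm_inv, norm_norm, inv_mul_cancel₀ hy0]
    · rw [inner_smul_left, real_inner_comm, (Submodule.mem_orthogonal W y).1 y.2 _ (huW i),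
        mul_zero]
    · cases i using Fin.cases with
      | zero => exact ⟨t, ht0, by simp [hTy, smul_comm t]⟩
      | succ i => simpa using hTu i

/-! ### Riesz means and Cesàro averages of a sequence -/

/-- For a nondecreasing positive sequence tending to infinity, the Cesàro averages are suprema of
Legendre type of the Riesz means. -/
theorem isLUB_sub_rieszMean {l : ℕ → ℝ} (hmono : ∀ i j, 1 ≤ i → i ≤ j → l i ≤ l j)
    (hfin : ∀ Λ : ℝ, {j : ℕ | 1 ≤ j ∧ l j < Λ}.Finite) {k : ℕ} (hk : 1 ≤ k) (hpos : 0 < l k) :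
    IsLUB ((fun Λ : ℝ => Λ - (∑ᶠ j ∈ {j : ℕ | 1 ≤ j ∧ l j < Λ}, max (Λ - l j) 0) / (k : ℝ)) ''
      Set.Ioi 0) ((1 / (k : ℝ)) * ∑ j ∈ Finset.Icc 1 k, l j) ∧
    l k - (∑ᶠ j ∈ {j : ℕ | 1 ≤ j ∧ l j < l k}, max (l k - l j) 0) / (k : ℝ) =
      (1 / (k : ℝ)) * ∑ j ∈ Finset.Icc 1 k, l j := by
  have hk0 : (0 : ℝ) < k := by exact_mod_cast hk
  have hsum : ∀ Λ : ℝ, ∑ j ∈ Finset.Icc 1 k, (Λ - l j) = k * Λ - ∑ j ∈ Finset.Icc 1 k, l j := by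
    intro Λ
    simp [Finset.sum_sub_distrib]
  have hle : ∀ Λ : ℝ, ∑ j ∈ Finset.Icc 1 k, (Λ - l j) ≤
      ∑ᶠ j ∈ {j : ℕ | 1 ≤ j ∧ l j < Λ}, max (Λ - l j) 0 := by
    intro Λ
    rw [finsum_mem_eq_finite_toFinset_sum _ (hfin Λ)]
    calc ∑ j ∈ Finset.Icc 1 k, (Λ - l j)
        ≤ ∑ j ∈ Finset.Icc 1 k with l j < Λ, (Λ - l j) := by
          rw [← Finset.sum_filter_add_sum_filter_not (Finset.Icc 1 k) (fun j => l j < Λ)]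
          refine add_le_of_nonpos_right (Finset.sum_nonpos fun j hj => ?_)
          linarith [(Finset.mem_filter.1 hj).2]
      _ ≤ ∑ j ∈ Finset.Icc 1 k with l j < Λ, max (Λ - l j) 0 :=
          Finset.sum_le_sum fun j _ => le_max_left _ _
      _ ≤ _ := by
          refine Finset.sum_le_sum_of_subset_of_nonneg (fun j hj => ?_)
            fun j _ _ => le_max_right _ _
          rw [Finset.mem_filter, Finset.mem_Icc] at hj
          simpa using ⟨hj.1.1, hj.2⟩
  have heq : ∑ᶠ j ∈ {j : ℕ | 1 ≤ j ∧ l j < l k}, max (l k - l j) 0 =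
      ∑ j ∈ Finset.Icc 1 k, (l k - l j) := by
    refine le_antisymm ?_ (hle _)
    rw [finsum_mem_eq_finite_toFinset_sum _ (hfin _)]
    -- The inclusion may be strict: indices `j ≤ k` with `l j = l k` contribute zero, so
    -- multiplicity does no harm.
    have hsub : (hfin (l k)).toFinset ⊆ Finset.Icc 1 k := fun j hj => by
      simp only [Set.Finite.mem_toFinset, Set.mem_ofPred_eq] at hj
      rw [Finset.mem_Icc]
      refine ⟨hj.1, ?_⟩
      by_contra! h
      exact absurd (hmono k j hk h.le) (not_le.2 hj.2)
    refine (Finset.sum_le_sum_of_subset_of_nonneg hsub fun j _ _ => le_max_right _ _).trans ?_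
    refine Finset.sum_le_sum fun j hj => ?_
    rw [Finset.mem_Icc] at hj
    rw [max_eq_left (sub_nonneg.2 (hmono j k hj.1 hj.2))]
  have hval : l k - (∑ᶠ j ∈ {j : ℕ | 1 ≤ j ∧ l j < l k}, max (l k - l j) 0) / (k : ℝ) =
      (1 / (k : ℝ)) * ∑ j ∈ Finset.Icc 1 k, l j := by
    rw [heq, hsum]
    field_simp
    ring
  refine ⟨⟨?_, fun b hb => ?_⟩, hval⟩
  · rintro _ ⟨Λ, -, rfl⟩
    have h := hle Λ
    rw [hsum] at h
    have h2 := div_le_div_of_nonneg_right h hk0.le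
    have h3 : (k * Λ - ∑ j ∈ Finset.Icc 1 k, l j) / (k : ℝ) =
        Λ - (1 / (k : ℝ)) * ∑ j ∈ Finset.Icc 1 k, l j := by field_simp
    rw [h3] at h2
    change Λ - _ ≤ _
    linarith
  · rw [← hval]
    exact hb ⟨l k, hpos, rfl⟩

/-! ### Translation estimates for smooth functions -/

/-- Cauchy–Schwarz inequality against the constant function `1`. -/
theorem sq_lintegral_le {α : Type*} [MeasurableSpace α] (μ : Measure α) {f : α → ENNReal}
    (hf : AEMeasurable f μ) : (∫⁻ a, f a ∂μ) ^ 2 ≤ μ Set.univ * ∫⁻ a, f a ^ 2 ∂μ := by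
  have h := ENNReal.lintegral_mul_le_Lp_mul_Lq μ Real.HolderConjugate.two_two hf
    (aemeasurable_const (b := (1 : ENNReal)))
  simp only [Pi.mul_apply, mul_one, lintegral_const, ENNReal.rpow_two, one_pow, one_mul] at h
  have key : ∀ c : ENNReal, (c ^ (1 / 2 : ℝ)) ^ 2 = c := fun c => by
    rw [← ENNReal.rpow_natCast, ← ENNReal.rpow_mul]; norm_num
  calc (∫⁻ a, f a ∂μ) ^ 2
      ≤ ((∫⁻ a, f a ^ 2 ∂μ) ^ (1 / 2 : ℝ) * μ Set.univ ^ (1 / 2 : ℝ)) ^ 2 := by gcongr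
    _ = _ := by rw [mul_pow, key, key, mul_comm]

section Translation

variable {E : Type*} [NormedAddCommGroup E] [NormedSpace ℝ E]

/-- The increment is the integral of the directional derivative along the segment from `x` to `x +
h`; Cauchy–Schwarz on `[0, 1]` moves the square inside. -/
theorem enorm_add_sub_sq_le {φ : E → ℝ} (hφ : ContDiff ℝ 1 φ) (x h : E) :
    ‖φ (x + h) - φ x‖ₑ ^ 2 ≤
      ‖h‖ₑ ^ 2 * ∫⁻ t in Set.Icc (0 : ℝ) 1, ‖fderiv ℝ φ (x + t • h)‖ₑ ^ 2 := by
  have hline : ContDiff ℝ 1 (fun t : ℝ => φ (x + t • h)) :=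
    hφ.comp (contDiff_const.add (contDiff_id.smul contDiff_const))
  have hc : Continuous fun t : ℝ => fderiv ℝ φ (x + t • h) :=
    (hφ.continuous_fderiv one_ne_zero).comp (by fun_prop)
  have hderiv : ∀ t : ℝ, deriv (fun t : ℝ => φ (x + t • h)) t = fderiv ℝ φ (x + t • h) h := by
    intro t
    have h1 : HasDerivAt (fun t : ℝ => x + t • h) h t := by
      simpa using ((hasDerivAt_id t).smul_const h).const_add x
    exact ((hφ.differentiable one_ne_zero _).hasFDerivAt.comp_hasDerivAt t h1).deriv
  have h1 := enorm_sub_le_lintegral_deriv_of_contDiffOn_Icc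
    (hline.contDiffOn (s := Set.Icc 0 1)) zero_le_one
  simp only [one_smul, zero_smul, add_zero, hderiv] at h1
  calc ‖φ (x + h) - φ x‖ₑ ^ 2
      ≤ (∫⁻ t in Set.Icc (0 : ℝ) 1, ‖fderiv ℝ φ (x + t • h) h‖ₑ) ^ 2 := by gcongr
    _ ≤ ∫⁻ t in Set.Icc (0 : ℝ) 1, ‖fderiv ℝ φ (x + t • h) h‖ₑ ^ 2 := by
      refine (sq_lintegral_le _ ?_).trans (by simp)
      exact (hc.clm_apply continuous_const).enorm.measurable.aemeasurable
    _ ≤ ∫⁻ t in Set.Icc (0 : ℝ) 1, ‖h‖ₑ ^ 2 * ‖fderiv ℝ φ (x + t • h)‖ₑ ^ 2 := by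
      refine lintegral_mono fun t => ?_
      rw [← mul_pow, mul_comm]
      gcongr
      exact ContinuousLinearMap.le_opENorm _ _
    _ = _ := lintegral_const_mul _ (hc.enorm.measurable.pow_const 2)

variable [FiniteDimensional ℝ E] [MeasurableSpace E] [BorelSpace E]

/-- Integrate the pointwise bound over `x` and exchange the integrals; by translation invariance the
inner one does not depend on `t`. -/
theorem lintegral_enorm_add_sub_sq_le (μ : Measure E) [μ.IsAddHaarMeasure] {φ : E → ℝ}
    (hφ : ContDiff ℝ 1 φ) (h : E) :
    ∫⁻ x, ‖φ (x + h) - φ x‖ₑ ^ 2 ∂μ ≤ ‖h‖ₑ ^ 2 * ∫⁻ x, ‖fderiv ℝ φ x‖ₑ ^ 2 ∂μ := by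
  have hc : Continuous fun p : E × ℝ => ‖fderiv ℝ φ (p.1 + p.2 • h)‖ₑ ^ 2 := by
    have := hφ.continuous_fderiv one_ne_zero
    have h2 : Continuous fun p : E × ℝ => ‖fderiv ℝ φ (p.1 + p.2 • h)‖ₑ :=
      (this.comp (by fun_prop : Continuous fun p : E × ℝ => p.1 + p.2 • h)).enorm
    exact (ENNReal.continuous_pow 2).comp h2
  calc ∫⁻ x, ‖φ (x + h) - φ x‖ₑ ^ 2 ∂μ
      ≤ ∫⁻ x, ‖h‖ₑ ^ 2 * (∫⁻ t in Set.Icc (0 : ℝ) 1, ‖fderiv ℝ φ (x + t • h)‖ₑ ^ 2) ∂μ :=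
        lintegral_mono fun x => enorm_add_sub_sq_le hφ x h
    _ = ‖h‖ₑ ^ 2 * ∫⁻ x, (∫⁻ t in Set.Icc (0 : ℝ) 1, ‖fderiv ℝ φ (x + t • h)‖ₑ ^ 2) ∂μ :=
        lintegral_const_mul' _ _ (by simp)
    _ = ‖h‖ₑ ^ 2 * ∫⁻ t in Set.Icc (0 : ℝ) 1, ∫⁻ x, ‖fderiv ℝ φ (x + t • h)‖ₑ ^ 2 ∂μ := by
        rw [lintegral_lintegral_swap hc.measurable.aemeasurable]
    _ = ‖h‖ₑ ^ 2 * ∫⁻ _ in Set.Icc (0 : ℝ) 1, ∫⁻ x, ‖fderiv ℝ φ x‖ₑ ^ 2 ∂μ := by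
        congr 1
        refine lintegral_congr fun t => ?_
        rw [lintegral_add_right_eq_self (fun x => ‖fderiv ℝ φ x‖ₑ ^ 2)]
    _ = _ := by simp

/-- The Friedrichs inequality: translate the support away from itself. -/
theorem lintegral_enorm_sq_le_of_disjoint_translate (μ : Measure E) [μ.IsAddHaarMeasure]
    {φ : E → ℝ} (hφ : ContDiff ℝ 1 φ) {h : E} (hdis : ∀ x, φ x ≠ 0 → φ (x + h) = 0) :
    ∫⁻ x, ‖φ x‖ₑ ^ 2 ∂μ ≤ ‖h‖ₑ ^ 2 * ∫⁻ x, ‖fderiv ℝ φ x‖ₑ ^ 2 ∂μ := by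
  refine le_trans (lintegral_mono fun x => ?_) (lintegral_enorm_add_sub_sq_le μ hφ h)
  rcases eq_or_ne (φ x) 0 with h0 | h0
  · simp [h0]
  · simp [hdis x h0]

end Translation

/-! ### Approximation by cell averages -/

/-- The half-open cube with index `n` in the partition of `ℝᵈ` into cubes of side length `ε`. -/
def gridCell {d : ℕ} (ε : ℝ) (n : Fin d → ℤ) : Set (EuclideanSpace ℝ (Fin d)) :=
  {x | ∀ i, ⌊x i / ε⌋ = n i}

/-- The index of the cell of side length `ε` that contains `x`. -/
noncomputable def gridIndex {d : ℕ} (ε : ℝ) (x : EuclideanSpace ℝ (Fin d)) : Fin d → ℤ :=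
  fun i => ⌊x i / ε⌋

theorem mem_gridCell_iff {d : ℕ} {ε : ℝ} {n : Fin d → ℤ} {x : EuclideanSpace ℝ (Fin d)} :
    x ∈ gridCell ε n ↔ gridIndex ε x = n := by
  simp [gridCell, gridIndex, funext_iff]

theorem measurableSet_gridCell {d : ℕ} (ε : ℝ) (n : Fin d → ℤ) :
    MeasurableSet (gridCell ε n) := by
  have : gridCell ε n = ⋂ i, (fun x : EuclideanSpace ℝ (Fin d) => ⌊x i / ε⌋) ⁻¹' {n i} := by
    ext x; simp [gridCell]
  rw [this]
  refine MeasurableSet.iInter fun i => ?_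
  have hm : Measurable fun x : EuclideanSpace ℝ (Fin d) => ⌊x i / ε⌋ := by fun_prop
  exact hm (measurableSet_singleton _)

theorem volume_gridCell {d : ℕ} {ε : ℝ} (hε : 0 < ε) (n : Fin d → ℤ) :
    volume (gridCell ε n) = ENNReal.ofReal ε ^ d := by
  have h : gridCell ε n = (@WithLp.ofLp 2 (Fin d → ℝ)) ⁻¹'
      (Set.univ.pi fun i => Set.Ico (n i * ε) ((n i + 1) * ε)) := by
    ext x
    simp [gridCell, Int.floor_eq_iff, le_div_iff₀ hε, div_lt_iff₀ hε]
  rw [h, (PiLp.volume_preserving_ofLp (Fin d)).measure_preimage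
    (MeasurableSet.univ_pi fun i => measurableSet_Ico).nullMeasurableSet, Real.volume_pi_Ico]
  simp [add_mul]

theorem volume_coordinate_cube {d : ℕ} (ε : ℝ) :
    volume {h : EuclideanSpace ℝ (Fin d) | ∀ i, |h i| < ε} = ENNReal.ofReal (2 * ε) ^ d := by
  have h : {h : EuclideanSpace ℝ (Fin d) | ∀ i, |h i| < ε} = (@WithLp.ofLp 2 (Fin d → ℝ)) ⁻¹'
      (Set.univ.pi fun _ => Set.Ioo (-ε) ε) := by
    ext x
    simp [abs_lt]
  rw [h, (PiLp.volume_preserving_ofLp (Fin d)).measure_preimage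
    (MeasurableSet.univ_pi fun i => measurableSet_Ioo).nullMeasurableSet, Real.volume_pi_Ioo]
  simp [two_mul]

theorem measurableSet_coordinate_cube {d : ℕ} (ε : ℝ) :
    MeasurableSet {h : EuclideanSpace ℝ (Fin d) | ∀ i, |h i| < ε} := by
  rw [Set.ofPred_forall]
  refine MeasurableSet.iInter fun i => measurableSet_lt ?_ measurable_const
  fun_prop

theorem enorm_sq_le_of_mem_coordinate_cube {d : ℕ} {ε : ℝ}
    {h : EuclideanSpace ℝ (Fin d)} (hh : ∀ i, |h i| < ε) :
    ‖h‖ₑ ^ 2 ≤ ENNReal.ofReal (d * ε ^ 2) := by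
  rw [← ofReal_norm, ← ENNReal.ofReal_pow (norm_nonneg _)]
  refine ENNReal.ofReal_le_ofReal ?_
  rw [EuclideanSpace.norm_sq_eq]
  calc ∑ i, ‖h i‖ ^ 2 ≤ ∑ _i : Fin d, ε ^ 2 := by
        refine Finset.sum_le_sum fun i _ => ?_
        rw [Real.norm_eq_abs]
        exact pow_le_pow_left₀ (abs_nonneg _) (hh i).le 2
    _ = _ := by simp

/-- The deviation from the average over a cell. -/
theorem enorm_sub_setAverage_sq_le {d : ℕ} {ε : ℝ} (hε : 0 < ε)
    {φ : EuclideanSpace ℝ (Fin d) → ℝ} (hφ : Continuous φ) (hφc : HasCompactSupport φ)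
    (x : EuclideanSpace ℝ (Fin d)) :
    ‖φ x - ⨍ y in gridCell ε (gridIndex ε x), φ y‖ₑ ^ 2 ≤
      (ENNReal.ofReal ε ^ d)⁻¹ * ∫⁻ h in {h : EuclideanSpace ℝ (Fin d) | ∀ i, |h i| < ε},
        ‖φ (x + h) - φ x‖ₑ ^ 2 := by
  set Q := gridCell ε (gridIndex ε x) with hQ
  set v := ENNReal.ofReal ε ^ d with hv
  have hQv : volume Q = v := volume_gridCell hε _
  have hv0 : v ≠ 0 := pow_ne_zero _ (by simpa using hε)
  have hvt : v ≠ ⊤ := ENNReal.pow_ne_top ENNReal.ofReal_ne_top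
  have hint : IntegrableOn φ Q := (hφ.integrable_of_hasCompactSupport hφc).integrableOn
  have hfin : IsFiniteMeasure (volume.restrict Q) := ⟨by simpa [hQv] using hvt.lt_top⟩
  have hne : NeZero (volume.restrict Q) := ⟨by simpa [hQv] using hv0⟩
  have havg : φ x - ⨍ y in Q, φ y = ⨍ y in Q, (φ x - φ y) := by
    conv_lhs => rw [← average_const (volume.restrict Q) (φ x)]
    rw [average_eq, average_eq, average_eq, integral_sub (integrable_const _) hint, smul_sub]
  have h1 : ‖φ x - ⨍ y in Q, φ y‖ₑ ≤ v⁻¹ * ∫⁻ y in Q, ‖φ x - φ y‖ₑ := by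
    rw [havg, average_eq, enorm_smul, measureReal_restrict_apply_univ]
    refine mul_le_mul' (le_of_eq ?_) (enorm_integral_le_lintegral_enorm _)
    rw [measureReal_def, hQv, Real.enorm_eq_ofReal (by positivity),
      ENNReal.ofReal_inv_of_pos (ENNReal.toReal_pos hv0 hvt), ENNReal.ofReal_toReal hvt]
  calc ‖φ x - ⨍ y in Q, φ y‖ₑ ^ 2
      ≤ (v⁻¹ * ∫⁻ y in Q, ‖φ x - φ y‖ₑ) ^ 2 := by gcongr
    _ = v⁻¹ ^ 2 * (∫⁻ y in Q, ‖φ x - φ y‖ₑ) ^ 2 := mul_pow _ _ _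
    _ ≤ v⁻¹ ^ 2 * (v * ∫⁻ y in Q, ‖φ x - φ y‖ₑ ^ 2) := by
        gcongr
        refine (sq_lintegral_le _ ?_).trans (by simp [hQv])
        exact (continuous_const.sub hφ).enorm.measurable.aemeasurable
    _ = v⁻¹ * ∫⁻ y in Q, ‖φ x - φ y‖ₑ ^ 2 := by
        rw [← mul_assoc, pow_two, mul_assoc v⁻¹, ENNReal.inv_mul_cancel hv0 hvt, mul_one]
    _ ≤ _ := by
        gcongr v⁻¹ * ?_
        -- Substitute `y = x + h`: points of one cell differ by less than `ε` in each coordinate, so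
        -- the displacements `h` lie in the cube.
        rw [← lintegral_indicator (measurableSet_gridCell _ _),
          ← lintegral_indicator (measurableSet_coordinate_cube ε),
          ← lintegral_add_left_eq_self _ x]
        refine lintegral_mono fun h => ?_
        by_cases hh : x + h ∈ Q
        · have hmem : h ∈ {h : EuclideanSpace ℝ (Fin d) | ∀ i, |h i| < ε} := fun i => by
            have h2 := mem_gridCell_iff.1 hh
            have h3 : ⌊(x i + h i) / ε⌋ = ⌊x i / ε⌋ := congrFun h2 i
            have h4 := Int.abs_sub_lt_one_of_floor_eq_floor h3
            rwa [← sub_div, add_sub_cancel_left, abs_div, abs_of_pos hε, div_lt_one hε] at h4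
          rw [Set.indicator_of_mem hh, Set.indicator_of_mem hmem, ← enorm_neg, neg_sub]
        · rw [Set.indicator_of_notMem hh]
          exact zero_le

/-- A smooth compactly supported function is close to its cell averages in `L²`. -/
theorem lintegral_enorm_sub_setAverage_sq_le {d : ℕ} {ε : ℝ} (hε : 0 < ε)
    {φ : EuclideanSpace ℝ (Fin d) → ℝ} (hφ : ContDiff ℝ 1 φ) (hφc : HasCompactSupport φ) :
    ∫⁻ x, ‖φ x - ⨍ y in gridCell ε (gridIndex ε x), φ y‖ₑ ^ 2 ≤
      ENNReal.ofReal (2 ^ d * d * ε ^ 2) * ∫⁻ x, ‖fderiv ℝ φ x‖ₑ ^ 2 := by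
  set B := {h : EuclideanSpace ℝ (Fin d) | ∀ i, |h i| < ε} with hB
  set v := ENNReal.ofReal ε ^ d with hv
  set D := ∫⁻ x, ‖fderiv ℝ φ x‖ₑ ^ 2 with hD
  have hv0 : v ≠ 0 := pow_ne_zero _ (by simpa using hε)
  have hvt : v ≠ ⊤ := ENNReal.pow_ne_top ENNReal.ofReal_ne_top
  have hc : Continuous fun p : EuclideanSpace ℝ (Fin d) × EuclideanSpace ℝ (Fin d) =>
      ‖φ (p.1 + p.2) - φ p.1‖ₑ ^ 2 := by
    have := hφ.continuous
    exact (ENNReal.continuous_pow 2).comp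
      (by fun_prop : Continuous fun p : EuclideanSpace ℝ (Fin d) × EuclideanSpace ℝ (Fin d) =>
        ‖φ (p.1 + p.2) - φ p.1‖ₑ)
  calc ∫⁻ x, ‖φ x - ⨍ y in gridCell ε (gridIndex ε x), φ y‖ₑ ^ 2
      ≤ ∫⁻ x, v⁻¹ * ∫⁻ h in B, ‖φ (x + h) - φ x‖ₑ ^ 2 :=
        lintegral_mono fun x => enorm_sub_setAverage_sq_le hε hφ.continuous hφc x
    _ = v⁻¹ * ∫⁻ x, ∫⁻ h in B, ‖φ (x + h) - φ x‖ₑ ^ 2 :=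
        lintegral_const_mul' _ _ (by simpa using hv0)
    _ = v⁻¹ * ∫⁻ h in B, ∫⁻ x, ‖φ (x + h) - φ x‖ₑ ^ 2 := by
        rw [lintegral_lintegral_swap hc.measurable.aemeasurable]
    _ ≤ v⁻¹ * ∫⁻ _ in B, ENNReal.ofReal (d * ε ^ 2) * D := by
        gcongr v⁻¹ * ?_
        refine setLIntegral_mono' (measurableSet_coordinate_cube ε) fun h hh => ?_
        refine (lintegral_enorm_add_sub_sq_le volume hφ h).trans ?_
        gcongr
        exact enorm_sq_le_of_mem_coordinate_cube hh
    -- The factor `2 ^ d` is the volume ratio of the cube of side `2ε` to a cell of side `ε`.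
    _ = ENNReal.ofReal (2 ^ d * d * ε ^ 2) * D := by
        rw [setLIntegral_const, volume_coordinate_cube, ENNReal.ofReal_mul zero_le_two, mul_pow,
          ← hv, mul_comm _ (_ * v), mul_comm _ v, mul_assoc, ← mul_assoc,
          ENNReal.inv_mul_cancel hv0 hvt, one_mul, ← mul_assoc, mul_assoc (2 ^ d : ℝ),
          ENNReal.ofReal_mul (p := 2 ^ d) (by positivity), ENNReal.ofReal_pow zero_le_two]

/-- An operator into a Hilbert space that is approximated on a dense set by finite-dimensional
subspaces is compact. -/
theorem ContinuousLinearMap.isCompactOperator_of_approx {H E : Type*} [NormedAddCommGroup H]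
    [NormedSpace ℝ H] [NormedAddCommGroup E] [InnerProductSpace ℝ E] [CompleteSpace E]
    (f : H →L[ℝ] E) {D : Set H} (hD : Dense D)
    (happ : ∀ δ : ℝ, 0 < δ → ∃ V : Submodule ℝ E, FiniteDimensional ℝ V ∧
      ∀ x ∈ D, ∃ v ∈ V, ‖f x - v‖ ≤ δ * ‖x‖) : IsCompactOperator f := by
  -- Compact operators are norm-closed, so it suffices to approximate `f` by its finite-rank
  -- projections onto `V`.
  refine isClosed_setOfPred_isCompactOperator.closure_subset (Metric.mem_closure_iff.2 ?_)
  intro δ hδ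
  obtain ⟨V, hV, hVD⟩ := happ (δ / 2) (by linarith)
  have hproj : ∀ y : E, ∀ v ∈ V, ‖y - V.starProjection y‖ ≤ ‖y - v‖ := fun y v hv => by
    have h1 : y - V.starProjection y = Vᗮ.starProjection (y - v) := by
      rw [Submodule.starProjection_orthogonal']
      simp [(Submodule.starProjection_eq_self_iff (K := V)).2 hv]
    rw [h1]
    exact (Vᗮ.starProjection.le_opNorm _).trans
      (mul_le_of_le_one_left (norm_nonneg _) Vᗮ.starProjection_norm_le)
  refine ⟨V.starProjection.comp f, ?_, ?_⟩
  · have : IsCompactOperator (V.orthogonalProjectionOnto.comp f) :=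
      isCompactOperator_of_locallyCompactSpace_dom _
    exact this.clm_comp V.subtypeL
  · rw [dist_eq_norm]
    refine (ContinuousLinearMap.opNorm_le_bound _ (by linarith : 0 ≤ δ / 2) fun x => ?_).trans_lt
      (half_lt_self hδ)
    refine hD.induction (P := fun x => ‖(f - V.starProjection.comp f) x‖ ≤ δ / 2 * ‖x‖) ?_ ?_ x
    · intro x hx
      obtain ⟨v, hv, h⟩ := hVD x hx
      exact (hproj (f x) v hv).trans h
    · exact isClosed_le (by fun_prop) (by fun_prop)

/-! ### Test functions as elements of the Sobolev space -/

theorem ofReal_norm_sq_eq_lintegral {α F : Type*} [MeasurableSpace α] {μ : Measure α}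
    [NormedAddCommGroup F] (f : Lp F 2 μ) :
    ENNReal.ofReal (‖f‖ ^ 2) = ∫⁻ x, ‖f x‖ₑ ^ 2 ∂μ := by
  have h := eLpNorm_nnreal_pow_eq_lintegral (f := f) (p := 2) (μ := μ) two_ne_zero
  simp only [NNReal.coe_ofNat, ENNReal.rpow_two] at h
  rw [ENNReal.ofReal_pow (norm_nonneg _), ofReal_norm, Lp.enorm_def, ← h]
  rfl

section Domain

variable {d : ℕ} {Ω : Set (EuclideanSpace ℝ (Fin d))}

theorem IsTestFunction.support_fderiv_subset {φ : EuclideanSpace ℝ (Fin d) → ℝ}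
    (hφ : IsTestFunction Ω φ) : Function.support (fderiv ℝ φ) ⊆ Ω :=
  (_root_.support_fderiv_subset ℝ).trans hφ.2.2

theorem IsTestFunction.contDiff_one {φ : EuclideanSpace ℝ (Fin d) → ℝ}
    (hφ : IsTestFunction Ω φ) : ContDiff ℝ 1 φ := hφ.1.of_le (by simp)

theorem enorm_gradient (φ : EuclideanSpace ℝ (Fin d) → ℝ) (x : EuclideanSpace ℝ (Fin d)) :
    ‖gradient φ x‖ₑ = ‖fderiv ℝ φ x‖ₑ := by
  rw [gradient, ← ofReal_norm, ← ofReal_norm, LinearIsometryEquiv.norm_map]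

theorem IsTestFunction.exists_testPair {φ : EuclideanSpace ℝ (Fin d) → ℝ}
    (hφ : IsTestFunction Ω φ) : ∃ p ∈ testPairs Ω, p.fst =ᵐ[volume.restrict Ω] φ := by
  have h1 : MemLp φ 2 (volume.restrict Ω) :=
    (hφ.1.continuous.memLp_of_hasCompactSupport hφ.2.1).restrict Ω
  have hc : Continuous (gradient φ) :=
    (InnerProductSpace.toDual ℝ (EuclideanSpace ℝ (Fin d))).symm.continuous.comp
      (hφ.contDiff_one.continuous_fderiv one_ne_zero)
  have hs : HasCompactSupport (gradient φ) :=
    (hφ.2.1.fderiv ℝ).comp_left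
      (g := (InnerProductSpace.toDual ℝ (EuclideanSpace ℝ (Fin d))).symm) (map_zero _)
  have h2 : MemLp (gradient φ) 2 (volume.restrict Ω) :=
    (hc.memLp_of_hasCompactSupport hs).restrict Ω
  exact ⟨WithLp.toLp 2 (h1.toLp φ, h2.toLp (gradient φ)),
    ⟨φ, hφ, h1.coeFn_toLp, h2.coeFn_toLp⟩, h1.coeFn_toLp⟩

theorem IsTestFunction.lintegral_enorm_fderiv_sq {φ : EuclideanSpace ℝ (Fin d) → ℝ}
    (hφ : IsTestFunction Ω φ) {g : L2Vec Ω} (hg : g =ᵐ[volume.restrict Ω] gradient φ) :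
    ∫⁻ x, ‖fderiv ℝ φ x‖ₑ ^ 2 = ENNReal.ofReal (‖g‖ ^ 2) := by
  rw [ofReal_norm_sq_eq_lintegral, ← setLIntegral_eq_of_support_subset (s := Ω)]
  · refine lintegral_congr_ae ?_
    filter_upwards [hg] with x hx
    rw [hx, enorm_gradient]
  · refine subset_trans (fun x hx => ?_) hφ.support_fderiv_subset
    contrapose! hx
    have h0 : fderiv ℝ φ x = 0 := by simpa using hx
    simp [Function.mem_support, h0, ← ofReal_norm]

/-! ### The Friedrichs inequality and the Rellich theorem -/

theorem norm_fst_le_of_mem_closure {C : ℝ} (h : ∀ p ∈ testPairs Ω, ‖p.fst‖ ≤ C * ‖p.snd‖)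
    {p : WithLp 2 (L2 Ω × L2Vec Ω)} (hp : p ∈ sobolevH10 Ω) : ‖p.fst‖ ≤ C * ‖p.snd‖ := by
  have hcl : IsClosed {p : WithLp 2 (L2 Ω × L2Vec Ω) | ‖p.fst‖ ≤ C * ‖p.snd‖} :=
    isClosed_le (WithLp.fstL 2 ℝ (L2 Ω) (L2Vec Ω)).continuous.norm
      (continuous_const.mul (WithLp.sndL 2 ℝ (L2 Ω) (L2Vec Ω)).continuous.norm)
  exact closure_minimal h hcl hp

theorem exists_friedrichs_constant (hd : 1 ≤ d) (hΩ : Bornology.IsBounded Ω) :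
    ∃ C : ℝ, 0 < C ∧ ∀ p ∈ sobolevH10 Ω, ‖p.fst‖ ≤ C * ‖p.snd‖ := by
  have : Nonempty (Fin d) := ⟨⟨0, hd⟩⟩
  obtain ⟨R, hR, hΩR⟩ := hΩ.exists_pos_norm_le
  -- Two points of `Ω` are at distance at most `2R`, so a shift of length `2R + 1` separates the
  -- support from its translate.
  obtain ⟨h, hh⟩ := exists_norm_eq (EuclideanSpace ℝ (Fin d)) (c := 2 * R + 1) (by linarith)
  refine ⟨2 * R + 1, by linarith, fun p hp => norm_fst_le_of_mem_closure ?_ hp⟩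
  rintro p ⟨φ, hφ, hp1, hp2⟩
  have hmem : ∀ x, φ x ≠ 0 → ‖x‖ ≤ R := fun x hx => hΩR x (hφ.2.2 (subset_tsupport φ hx))
  have h1 := lintegral_enorm_sq_le_of_disjoint_translate volume hφ.contDiff_one (h := h)
    fun x hx => by
      by_contra hxh
      have h2 := norm_sub_le (x + h) x
      rw [add_sub_cancel_left, hh] at h2
      linarith [hmem x hx, hmem _ hxh]
  rw [hφ.lintegral_enorm_fderiv_sq hp2] at h1
  have h2 : ENNReal.ofReal (‖p.fst‖ ^ 2) ≤ ENNReal.ofReal ((2 * R + 1) ^ 2 * ‖p.snd‖ ^ 2) := by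
    rw [ofReal_norm_sq_eq_lintegral, ENNReal.ofReal_mul (by positivity), ← hh,
      ENNReal.ofReal_pow (norm_nonneg _), ofReal_norm]
    refine le_trans ?_ h1
    refine le_trans (le_of_eq (lintegral_congr_ae ?_)) (setLIntegral_le_lintegral Ω _)
    filter_upwards [hp1] with x hx
    rw [hx]
  rw [ENNReal.ofReal_le_ofReal_iff (by positivity), ← mul_pow] at h2
  exact (sq_le_sq₀ (norm_nonneg _) (by positivity)).1 h2

theorem finite_gridIndex_image (hΩ : Bornology.IsBounded Ω) {ε : ℝ} (hε : 0 < ε) :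
    (gridIndex ε '' Ω).Finite := by
  obtain ⟨R, -, hΩR⟩ := hΩ.exists_pos_norm_le
  refine (Set.finite_Icc (fun _ : Fin d => ⌊-R / ε⌋) (fun _ => ⌊R / ε⌋)).subset ?_
  rintro _ ⟨x, hx, rfl⟩
  have hi : ∀ i, |x i| ≤ R := fun i => (PiLp.norm_apply_le x i).trans (hΩR x hx)
  constructor <;> intro i <;> refine Int.floor_le_floor ?_ <;> gcongr
  · exact (abs_le.1 (hi i)).1
  · exact (abs_le.1 (hi i)).2

theorem exists_finiteDimensional_approx (hΩo : IsOpen Ω) (hΩ : Bornology.IsBounded Ω) {δ : ℝ}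
    (hδ : 0 < δ) : ∃ V : Submodule ℝ (L2 Ω), FiniteDimensional ℝ V ∧
      ∀ p ∈ testPairs Ω, ∃ v ∈ V, ‖p.fst - v‖ ≤ δ * ‖p.snd‖ := by
  -- The added `1` gives `M ≤ M²`, so `ε = δ / M` makes the cell-average constant at most `δ²`
  -- without a square root.
  set M : ℝ := 2 ^ d * d + 1 with hM
  have hM1 : 1 ≤ M := by rw [hM]; linarith [show (0 : ℝ) ≤ 2 ^ d * d by positivity]
  set ε := δ / M with hε_def
  have hε : 0 < ε := by positivity
  have hbound : 2 ^ d * d * ε ^ 2 ≤ δ ^ 2 := by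
    calc 2 ^ d * d * ε ^ 2 ≤ M * ε ^ 2 := by gcongr; linarith
      _ ≤ M ^ 2 * ε ^ 2 := by gcongr; nlinarith
      _ = δ ^ 2 := by rw [hε_def]; field_simp
  have hne : ∀ n, (volume.restrict Ω) (gridCell ε n) ≠ ⊤ := fun n =>
    ((Measure.restrict_apply_le _ _).trans_lt (by rw [volume_gridCell hε]; simp)).ne
  let e : (Fin d → ℤ) → L2 Ω := fun n =>
    indicatorConstLp 2 (measurableSet_gridCell ε n) (hne n) (1 : ℝ)
  have hN := finite_gridIndex_image hΩ hε
  refine ⟨Submodule.span ℝ (e '' (gridIndex ε '' Ω)),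
    FiniteDimensional.span_of_finite ℝ (hN.image e), ?_⟩
  rintro p ⟨φ, hφ, hp1, hp2⟩
  let a : (Fin d → ℤ) → ℝ := fun n => ⨍ y in gridCell ε n, φ y
  set v : L2 Ω := ∑ n ∈ hN.toFinset, a n • e n with hv
  refine ⟨v, Submodule.sum_mem _ fun n hn => Submodule.smul_mem _ _ (Submodule.subset_span
    ⟨n, hN.mem_toFinset.1 hn, rfl⟩), ?_⟩
  have hvx : v =ᵐ[volume.restrict Ω] fun x => a (gridIndex ε x) := by
    have h1 : ∀ᵐ x ∂volume.restrict Ω, ∀ n,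
        (a n • e n : L2 Ω) x = a n * (gridCell ε n).indicator (fun _ => (1 : ℝ)) x := by
      rw [ae_all_iff]
      intro n
      filter_upwards [Lp.coeFn_smul (a n) (e n), indicatorConstLp_coeFn (p := 2)
        (hs := measurableSet_gridCell ε n) (hμs := hne n) (c := (1 : ℝ))] with x h2 h3
      rw [h2, Pi.smul_apply, h3, smul_eq_mul]
    filter_upwards [Lp.coeFn_finsetSum hN.toFinset (fun n => a n • e n), h1,
      ae_restrict_mem hΩo.measurableSet] with x h2 h3 hx
    rw [hv, h2, Finset.sum_apply]
    simp only [h3]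
    rw [Finset.sum_eq_single (gridIndex ε x)]
    · rw [Set.indicator_of_mem (mem_gridCell_iff.2 rfl), mul_one]
    · intro n _ hn
      rw [Set.indicator_of_notMem (fun h => hn (mem_gridCell_iff.1 h).symm), mul_zero]
    · intro h
      exact absurd (hN.mem_toFinset.2 ⟨x, hx, rfl⟩) h
  have h2 : ENNReal.ofReal (‖p.fst - v‖ ^ 2) ≤ ENNReal.ofReal (δ ^ 2 * ‖p.snd‖ ^ 2) := by
    calc ENNReal.ofReal (‖p.fst - v‖ ^ 2)
        = ∫⁻ x in Ω, ‖φ x - a (gridIndex ε x)‖ₑ ^ 2 := by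
          rw [ofReal_norm_sq_eq_lintegral]
          refine lintegral_congr_ae ?_
          filter_upwards [Lp.coeFn_sub p.fst v, hp1, hvx] with x h3 h4 h5
          rw [h3, Pi.sub_apply, h4, h5]
      _ ≤ ∫⁻ x, ‖φ x - a (gridIndex ε x)‖ₑ ^ 2 := setLIntegral_le_lintegral Ω _
      _ ≤ ENNReal.ofReal (2 ^ d * d * ε ^ 2) * ∫⁻ x, ‖fderiv ℝ φ x‖ₑ ^ 2 :=
          lintegral_enorm_sub_setAverage_sq_le hε hφ.contDiff_one hφ.2.1
      _ ≤ _ := by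
          rw [hφ.lintegral_enorm_fderiv_sq hp2, ← ENNReal.ofReal_mul (by positivity)]
          gcongr
  rw [ENNReal.ofReal_le_ofReal_iff (by positivity), ← mul_pow] at h2
  exact (sq_le_sq₀ (norm_nonneg _) (by positivity)).1 h2

/-- The embedding `H¹₀(Ω) → L²(Ω)`. -/
noncomputable def sobolevEmbedding (Ω : Set (EuclideanSpace ℝ (Fin d))) :
    sobolevH10 Ω →L[ℝ] L2 Ω :=
  (WithLp.fstL 2 ℝ (L2 Ω) (L2Vec Ω)).comp (sobolevH10 Ω).subtypeL

theorem testPairs_le_sobolevH10 : testPairs Ω ≤ sobolevH10 Ω :=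
  Submodule.le_topologicalClosure _

instance completeSpace_sobolevH10 : CompleteSpace (sobolevH10 Ω) :=
  (Submodule.isClosed_topologicalClosure (testPairs Ω)).completeSpace_coe

/-- **Rellich's theorem**: for bounded `Ω` the embedding `H¹₀(Ω) → L²(Ω)` is compact. -/
theorem isCompactOperator_sobolevEmbedding (hΩo : IsOpen Ω) (hΩ : Bornology.IsBounded Ω) :
    IsCompactOperator (sobolevEmbedding Ω) := by
  have hdense : Dense (Set.range (Set.inclusion (testPairs_le_sobolevH10 (Ω := Ω)))) :=
    (denseRange_inclusion_iff _).2 subset_rfl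
  refine (sobolevEmbedding Ω).isCompactOperator_of_approx hdense fun δ hδ => ?_
  obtain ⟨V, hV, happ⟩ := exists_finiteDimensional_approx hΩo hΩ hδ
  refine ⟨V, hV, ?_⟩
  rintro _ ⟨p, rfl⟩
  obtain ⟨v, hv, h⟩ := happ p p.2
  refine ⟨v, hv, h.trans ?_⟩
  gcongr
  exact WithLp.norm_snd_le (L2 Ω) (p : WithLp 2 (L2 Ω × L2Vec Ω))

end Domain

section Eigenvalues

variable {d : ℕ} {Ω : Set (EuclideanSpace ℝ (Fin d))}

/-! ### Existence of eigenfunctions -/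

/-- Nonempty open sets carry arbitrarily many linearly independent test functions. -/
theorem exists_linearIndependent_testFunctions (hd : 1 ≤ d) (hΩo : IsOpen Ω) (hne : Ω.Nonempty)
    (n : ℕ) : ∃ (s : Finset (EuclideanSpace ℝ (Fin d))) (b : s → L2 Ω), s.card = n ∧
      LinearIndependent ℝ b ∧ ∀ i, ∃ p ∈ testPairs Ω, p.fst = b i := by
  have : Nonempty (Fin d) := ⟨⟨0, hd⟩⟩
  obtain ⟨x₀, hx₀⟩ := hne
  have hinf : Ω.Infinite := infinite_of_mem_nhds x₀ (hΩo.mem_nhds hx₀)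
  obtain ⟨s, hsΩ, hs⟩ := hinf.exists_subset_card_eq n
  obtain ⟨U, hU, hdisj⟩ := s.finite_toSet.t2_separation
  have hex : ∀ i : s, ∃ φ : EuclideanSpace ℝ (Fin d) → ℝ, IsTestFunction Ω φ ∧
      tsupport φ ⊆ U i ∧ φ i = 1 := fun i => by
    obtain ⟨φ, h1, h2, h3, -, h5⟩ := exists_contDiff_tsupport_subset (n := ⊤)
      (((hU i).2.inter hΩo).mem_nhds ⟨(hU i).1, hsΩ i.2⟩)
    exact ⟨φ, ⟨h3, h2, h1.trans Set.inter_subset_right⟩, h1.trans Set.inter_subset_left, h5⟩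
  choose φ hφ hφU hφ1 using hex
  choose p hp hpφ using fun i => (hφ i).exists_testPair
  refine ⟨s, fun i => (p i).fst, hs, ?_, fun i => ⟨p i, hp i, rfl⟩⟩
  refine linearIndependent_of_ne_zero_of_inner_eq_zero (𝕜 := ℝ) (fun i h0 => ?_)
    fun i j hij => ?_
  · have h1 : φ i =ᵐ[volume.restrict Ω] (fun _ => (0 : ℝ)) :=
      (hpφ i).symm.trans (h0 ▸ Lp.coeFn_zero ℝ 2 (volume.restrict Ω))
    have h2 := Measure.eqOn_open_of_ae_eq h1 hΩo (hφ i).1.continuous.continuousOn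
      continuousOn_const (hsΩ i.2)
    rw [hφ1] at h2
    exact one_ne_zero h2
  · change inner ℝ (p i).fst (p j).fst = 0
    rw [L2.inner_def]
    refine integral_eq_zero_of_ae ?_
    filter_upwards [hpφ i, hpφ j] with x hi hj
    rw [hi, hj]
    by_cases hxi : φ i x = 0
    · simp [hxi]
    · have hxj : φ j x = 0 := by
        by_contra hxj
        exact Set.disjoint_left.1 (hdisj i.2 j.2 fun h => hij (Subtype.ext h))
          (hφU i (subset_tsupport _ hxi)) (hφU j (subset_tsupport _ hxj))
      simp [hxj]

/-- The solution operator `(1 - Δ)⁻¹` on `L²(Ω)` with Dirichlet boundary conditions. -/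
noncomputable def dirichletResolvent (Ω : Set (EuclideanSpace ℝ (Fin d))) : L2 Ω →L[ℝ] L2 Ω :=
  (sobolevEmbedding Ω).comp (sobolevEmbedding Ω).adjoint

theorem isSymmetric_dirichletResolvent : (dirichletResolvent Ω).IsSymmetric := by
  intro x y
  simp only [ContinuousLinearMap.coe_coe, dirichletResolvent, ContinuousLinearMap.comp_apply]
  exact (ContinuousLinearMap.adjoint_inner_right _ _ _).symm.trans
    (ContinuousLinearMap.adjoint_inner_left _ _ _)

theorem isCompactOperator_dirichletResolvent (hΩo : IsOpen Ω) (hΩ : Bornology.IsBounded Ω) :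
    IsCompactOperator (dirichletResolvent Ω) :=
  (isCompactOperator_sobolevEmbedding hΩo hΩ).comp_clm _

/-- The adjoint of the embedding sends `u` to the `H¹₀` element `w` representing `v ↦ ⟨u, v⟩` in the
full Sobolev inner product. As `w` has function part `t u`, this reads `t ⟨u, v⟩ + ⟨∇w, ∇v⟩ = ⟨u,
v⟩`; division by `t` gives the eigenvalue `t⁻¹ - 1`. -/
theorem isDirichletEigenpair_of_dirichletResolvent {u : L2 Ω} {t : ℝ} (hu : u ≠ 0) (ht : t ≠ 0)
    (h : dirichletResolvent Ω u = t • u) : IsDirichletEigenpair Ω (t⁻¹ - 1) u := by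
  set w := (sobolevEmbedding Ω).adjoint u with hw
  have hw1 : (w : WithLp 2 (L2 Ω × L2Vec Ω)).fst = t • u := h
  refine ⟨hu, t⁻¹ • (w : WithLp 2 (L2 Ω × L2Vec Ω)).snd, ?_, fun v hv => ?_⟩
  · have h1 : WithLp.toLp 2 (u, t⁻¹ • (w : WithLp 2 (L2 Ω × L2Vec Ω)).snd) =
        t⁻¹ • (w : WithLp 2 (L2 Ω × L2Vec Ω)) := by
      have h2 : u = t⁻¹ • (w : WithLp 2 (L2 Ω × L2Vec Ω)).fst := by
        rw [hw1, inv_smul_smul₀ ht]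
      conv_lhs => rw [h2]
      rfl
    rw [h1]
    exact Submodule.smul_mem _ _ w.2
  · have h1 : inner ℝ w (⟨v, hv⟩ : sobolevH10 Ω) = inner ℝ u v.fst := by
      rw [hw, ContinuousLinearMap.adjoint_inner_left]
      rfl
    rw [Submodule.coe_inner, WithLp.prod_inner_apply] at h1
    change inner ℝ (w : WithLp 2 (L2 Ω × L2Vec Ω)).fst v.fst +
      inner ℝ (w : WithLp 2 (L2 Ω × L2Vec Ω)).snd v.snd = inner ℝ u v.fst at h1
    rw [hw1, real_inner_smul_left] at h1
    rw [real_inner_smul_left, eq_sub_of_add_eq' h1]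
    field_simp

/-- If `J J* x = 0` then `‖J* x‖² = ⟨x, J J* x⟩ = 0`, so `x` is orthogonal to the range of `J`. Were
this so for all `x ∈ Wᗮ`, every test function would lie in `Wᗮᗮ = W`, contradicting finite
dimension. -/
theorem exists_dirichletResolvent_ne_zero (hd : 1 ≤ d) (hΩo : IsOpen Ω) (hne : Ω.Nonempty)
    (W : Submodule ℝ (L2 Ω)) [FiniteDimensional ℝ W] :
    ∃ x ∈ Wᗮ, dirichletResolvent Ω x ≠ 0 := by
  by_contra! h
  have hW : ∀ p ∈ testPairs Ω, p.fst ∈ W := fun p hp => by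
    rw [← W.orthogonal_orthogonal, Submodule.mem_orthogonal]
    intro x hx
    have h1 : (sobolevEmbedding Ω).adjoint x = 0 := by
      rw [← inner_self_eq_zero (𝕜 := ℝ), ContinuousLinearMap.adjoint_inner_left]
      have h2 : sobolevEmbedding Ω ((sobolevEmbedding Ω).adjoint x) = 0 := h x hx
      rw [h2, inner_zero_right]
    have h2 := ContinuousLinearMap.adjoint_inner_left (sobolevEmbedding Ω)
      ⟨p, testPairs_le_sobolevH10 hp⟩ x
    rw [h1, inner_zero_left] at h2
    exact h2.symm
  obtain ⟨s, b, hs, hb, hbp⟩ := exists_linearIndependent_testFunctions hd hΩo hne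
    (Module.finrank ℝ W + 1)
  have hbW : ∀ i, b i ∈ W := fun i => by
    obtain ⟨p, hp, hpb⟩ := hbp i
    exact hpb ▸ hW p hp
  have hb' : LinearIndependent ℝ fun i => (⟨b i, hbW i⟩ : W) :=
    LinearIndependent.of_comp W.subtype hb
  have := hb'.fintype_card_le_finrank
  rw [Fintype.card_coe, hs] at this
  omega

/-- A bounded domain has arbitrarily many orthonormal Dirichlet eigenfunctions. -/
theorem exists_orthonormal_eigenfunctions (hd : 1 ≤ d) (hΩo : IsOpen Ω) (hne : Ω.Nonempty)
    (hΩ : Bornology.IsBounded Ω) (k : ℕ) :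
    {Λ : ℝ | ∃ u : Fin k → L2 Ω, Orthonormal ℝ u ∧
      ∀ i, ∃ μ ≤ Λ, IsDirichletEigenpair Ω μ (u i)}.Nonempty := by
  obtain ⟨u, hu, hT⟩ := ContinuousLinearMap.exists_orthonormal_eigenvectors
    (isCompactOperator_dirichletResolvent hΩo hΩ) isSymmetric_dirichletResolvent
    (fun W _ => exists_dirichletResolvent_ne_zero hd hΩo hne W) k
  choose t ht hTu using hT
  obtain ⟨Λ, hΛ⟩ := (Set.finite_range fun i => (t i)⁻¹ - 1).bddAbove
  exact ⟨Λ, u, hu, fun i => ⟨_, hΛ ⟨i, rfl⟩,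
    isDirichletEigenpair_of_dirichletResolvent (hu.ne_zero i) (ht i) (hTu i)⟩⟩

/-! ### Properties of the eigenvalues -/

theorem IsDirichletEigenpair.exists_norm_gradient_sq {μ : ℝ} {u : L2 Ω}
    (h : IsDirichletEigenpair Ω μ u) : ∃ g : L2Vec Ω, WithLp.toLp 2 (u, g) ∈ sobolevH10 Ω ∧
      ‖g‖ ^ 2 = μ * ‖u‖ ^ 2 := by
  obtain ⟨-, g, hg, hv⟩ := h
  refine ⟨g, hg, ?_⟩
  have := hv _ hg
  simpa [real_inner_self_eq_norm_sq] using this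

/-- Testing the equation with `u` itself gives `‖∇u‖² = μ ‖u‖²`, and Friedrichs bounds this below. A
bound uniform in `μ` is needed because `λ_k` is an infimum. -/
theorem exists_pos_le_eigenvalue (hd : 1 ≤ d) (hΩ : Bornology.IsBounded Ω) :
    ∃ c : ℝ, 0 < c ∧ ∀ μ u, IsDirichletEigenpair Ω μ u → c ≤ μ := by
  obtain ⟨C, hC, hF⟩ := exists_friedrichs_constant hd hΩ
  refine ⟨(C ^ 2)⁻¹, by positivity, fun μ u h => ?_⟩
  obtain ⟨g, hg, hgn⟩ := h.exists_norm_gradient_sq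
  have h1 := hF _ hg
  rw [WithLp.toLp_fst, WithLp.toLp_snd] at h1
  have h2 : 0 < ‖u‖ := norm_pos_iff.2 h.1
  generalize ‖u‖ = a at h1 h2 hgn
  generalize ‖g‖ = b at h1 hgn
  have h3 : 1 * a ^ 2 ≤ μ * C ^ 2 * a ^ 2 := by
    calc 1 * a ^ 2 ≤ (C * b) ^ 2 := by rw [one_mul]; gcongr
      _ = μ * C ^ 2 * a ^ 2 := by rw [mul_pow, hgn]; ring
  rw [inv_le_iff_one_le_mul₀ (by positivity)]
  exact le_of_mul_le_mul_right h3 (by positivity)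

theorem le_of_mem_eigenvalueBounds {c : ℝ} (hc : ∀ μ u, IsDirichletEigenpair Ω μ u → c ≤ μ)
    {k : ℕ} (hk : 1 ≤ k) {Λ : ℝ} (hΛ : ∃ u : Fin k → L2 Ω, Orthonormal ℝ u ∧
      ∀ i, ∃ μ ≤ Λ, IsDirichletEigenpair Ω μ (u i)) : c ≤ Λ := by
  obtain ⟨u, -, h⟩ := hΛ
  obtain ⟨μ, hμ, hu⟩ := h ⟨0, hk⟩
  exact (hc μ _ hu).trans hμ

theorem dirichletEigenvalue_pos (hd : 1 ≤ d) (hΩo : IsOpen Ω) (hne : Ω.Nonempty)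
    (hΩ : Bornology.IsBounded Ω) {k : ℕ} (hk : 1 ≤ k) : 0 < dirichletEigenvalue Ω k := by
  obtain ⟨c, hc0, hc⟩ := exists_pos_le_eigenvalue hd hΩ
  exact hc0.trans_le (le_csInf (exists_orthonormal_eigenfunctions hd hΩo hne hΩ k)
    fun Λ hΛ => le_of_mem_eigenvalueBounds hc hk hΛ)

theorem dirichletEigenvalue_mono (hd : 1 ≤ d) (hΩo : IsOpen Ω) (hne : Ω.Nonempty)
    (hΩ : Bornology.IsBounded Ω) {i j : ℕ} (hi : 1 ≤ i) (hij : i ≤ j) :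
    dirichletEigenvalue Ω i ≤ dirichletEigenvalue Ω j := by
  obtain ⟨c, -, hc⟩ := exists_pos_le_eigenvalue hd hΩ
  refine csInf_le_csInf ⟨c, fun Λ hΛ => le_of_mem_eigenvalueBounds hc hi hΛ⟩
    (exists_orthonormal_eigenfunctions hd hΩo hne hΩ j) ?_
  rintro Λ ⟨u, hu, h⟩
  -- Dropping eigenfunctions from an admissible family of `j` leaves one of `i` with the same bound.
  exact ⟨u ∘ Fin.castLE hij, hu.comp _ (Fin.castLE_injective hij), fun m => h _⟩

/-- The Dirichlet eigenvalues tend to infinity. -/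
theorem finite_dirichletEigenvalue_lt (hd : 1 ≤ d) (hΩo : IsOpen Ω) (hne : Ω.Nonempty)
    (hΩ : Bornology.IsBounded Ω) (Λ : ℝ) :
    {j : ℕ | 1 ≤ j ∧ dirichletEigenvalue Ω j < Λ}.Finite := by
  -- A unit eigenfunction with `μ < Λ` has squared Sobolev norm `1 + μ ≤ (1 + |Λ|)²`, which explains
  -- the radius.
  obtain ⟨K, hK, hKsub⟩ :=
    (isCompactOperator_sobolevEmbedding hΩo hΩ).image_closedBall_subset_compact
      (f := (sobolevEmbedding Ω : sobolevH10 Ω →ₗ[ℝ] L2 Ω)) (1 + |Λ|)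
  obtain ⟨N, hN⟩ := hK.exists_card_orthonormal_le
  refine (Set.finite_Iic N).subset fun j ⟨_, hjΛ⟩ => ?_
  obtain ⟨Λ', ⟨u, hu, hμ⟩, hΛ'⟩ := exists_lt_of_csInf_lt
    (exists_orthonormal_eigenfunctions hd hΩo hne hΩ j) hjΛ
  refine hN j u hu fun i => ?_
  obtain ⟨μ, hμΛ, hpair⟩ := hμ i
  obtain ⟨g, hg, hgn⟩ := hpair.exists_norm_gradient_sq
  refine hKsub ⟨⟨_, hg⟩, ?_, rfl⟩
  rw [mem_closedBall_zero_iff, Submodule.coe_norm]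
  refine abs_le_of_sq_le_sq' ?_ (by positivity) |>.2
  rw [WithLp.prod_norm_sq_eq_of_L2]
  change ‖u i‖ ^ 2 + ‖g‖ ^ 2 ≤ _
  rw [hgn, hu.1 i]
  nlinarith [le_abs_self Λ, abs_nonneg Λ]

end Eigenvalues

/-! ### The variational formula for Dirichlet eigenvalues -/

theorem lemma6p2 {d : ℕ} (hd : 1 ≤ d) (Ω : Set (EuclideanSpace ℝ (Fin d)))
    (hΩ_open : IsOpen Ω) (hΩ_conn : IsConnected Ω) (hΩ_bdd : Bornology.IsBounded Ω)
    (k : ℕ) (hk : 1 ≤ k) :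
    -- the sums defining the Riesz means are finite
    (∀ Λ : ℝ, {j : ℕ | 1 ≤ j ∧ dirichletEigenvalue Ω j < Λ}.Finite) ∧
    -- the Cesàro average is the supremum over all positive `Λ`
    IsLUB ((fun Λ : ℝ => Λ - rieszMean Ω Λ / (k : ℝ)) '' Set.Ioi 0) (cesaroAverage Ω k) ∧
    -- the supremum is attained at the admissible point `λ_k`
    0 < dirichletEigenvalue Ω k ∧
    dirichletEigenvalue Ω k - rieszMean Ω (dirichletEigenvalue Ω k) / (k : ℝ)
      = cesaroAverage Ω k := by
  have hne := hΩ_conn.nonempty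
  have hfin := finite_dirichletEigenvalue_lt hd hΩ_open hne hΩ_bdd
  have hpos := dirichletEigenvalue_pos hd hΩ_open hne hΩ_bdd hk
  obtain ⟨hsup, hval⟩ := isLUB_sub_rieszMean
    (fun i j hi hij => dirichletEigenvalue_mono hd hΩ_open hne hΩ_bdd hi hij) hfin hk hpos
  exact ⟨hfin, hsup, hpos, hval⟩
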